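/- Let $E$ be $\mathbb{R}^d$ equipped with an arbitrary norm $\|\cdot\|$ (any finite-dimensional real normed space), let $\mu$ be Lebesgue measure on $E$ (any Haar measure), let $\mathbb{P}_0,\mathbb{P}_1$ be finite Borel measures on $E$, put $\mathbb{P}=\mathbb{P}_0+\mathbb{P}_1$, and let $\epsilon\ge 0$. For $g:E\to[0,\infty]$ let $S_\epsilon(g)(x)=\sup_{\|h\|\le\epsilon}g(x+h)$, and for a Borel set $A\subset E$ let \[R^\epsilon(A)=\int S_\epsilon(\mathbf{1}_{A^C})\,d\mathbb{P}_1+\int S_\epsilon(\mathbf{1}_{A})\,d\mathbb{P}_0,\] the integrals being taken with respect to the completions of the measures. A Borel set minimizing $R^\epsilon$ over all Borel sets is called an adversarial Bayes classifier. Two adversarial Bayes classifiers $A_1,A_2$ are equivalent up to degeneracy if every Borel set $B$ with $A_1\cap A_2\subset B\subset A_1\cup A_2$ is an adversarial Bayes classifier. (1) If $\mathbb{P}\ll\mu$, then equivalence up to degeneracy is an equivalence relation on the set of adversarial Bayes classifiers. (2) Absolute continuity is needed: on $\mathbb{R}$ with the norm $|\cdot|$, for every $\epsilon>0$ and $\mathbb{P}_0=\frac12\delta_{-\epsilon}$,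 $\mathbb{P}_1=\frac12\delta_{\epsilon}$, the sets $(0,\infty)$, $[0,\infty)$ and $\mathbb{R}$ are adversarial Bayes classifiers; $(0,\infty)$ and $[0,\infty)$ are equivalent up to degeneracy, $[0,\infty)$ and $\mathbb{R}$ are equivalent up to degeneracy, but $(0,\infty)$ and $\mathbb{R}$ are not. In particular, equivalence up to degeneracy is not an equivalence relation for these measures. -/

import Mathlib

open MeasureTheory Set
open scoped ENNReal

namespace AdvBayes

section

variable {E : Type*} [NormedAddCommGroup E]

/-- The operation `S_ε(g)(x) = sup_{‖h‖ ≤ ε} g (x + h)`. -/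
noncomputable def supBall (ε : ℝ) (g : E → ℝ≥0∞) (x : E) : ℝ≥0∞ :=
  ⨆ (h : E) (_ : ‖h‖ ≤ ε), g (x + h)

variable [MeasurableSpace E]

/-- The adversarial classification risk
`R^ε(A) = ∫ S_ε(1_{Aᶜ}) dP₁ + ∫ S_ε(1_A) dP₀`.  For Borel `A` the function `S_ε(1_A)` need not be
Borel measurable (it is universally measurable), so the integrals are taken with respect to the
completions of `P₁` and `P₀`. -/
noncomputable def advRisk (ε : ℝ) (P₀ P₁ : Measure E) (A : Set E) : ℝ≥0∞ :=
  (∫⁻ x, supBall ε (Aᶜ.indicator fun _ => 1) x ∂P₁.completion) +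
    ∫⁻ x, supBall ε (A.indicator fun _ => 1) x ∂P₀.completion

/-- An adversarial Bayes classifier: a minimizer of the adversarial classification risk among
Borel sets (the measurable sets, in a Borel space). -/
def IsAdvBayesClassifier (ε : ℝ) (P₀ P₁ : Measure E) (A : Set E) : Prop :=
  MeasurableSet A ∧ ∀ B : Set E, MeasurableSet B → advRisk ε P₀ P₁ A ≤ advRisk ε P₀ P₁ B

/-- The set of all adversarial Bayes classifiers, as a type. -/
abbrev AdvBayesClassifier (ε : ℝ) (P₀ P₁ : Measure E) : Type _ :=
  {A : Set E // IsAdvBayesClassifier ε P₀ P₁ A}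

/-- Two adversarial Bayes classifiers `A₁`, `A₂` are equivalent up to degeneracy if every Borel set
`B` with `A₁ ∩ A₂ ⊆ B ⊆ A₁ ∪ A₂` is an adversarial Bayes classifier. -/
def EquivUpToDegeneracy {ε : ℝ} {P₀ P₁ : Measure E} (A₁ A₂ : AdvBayesClassifier ε P₀ P₁) : Prop :=
  ∀ B : Set E, MeasurableSet B → A₁.1 ∩ A₂.1 ⊆ B → B ⊆ A₁.1 ∪ A₂.1 →
    IsAdvBayesClassifier ε P₀ P₁ B

end

end AdvBayes

/-! Let ε > 0 and let the measures be absolutely continuous. Closed and open ε-thickenings then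
agree up to null sets (`cthickening_ae_eq_thickening`), so the risk sees only open thickenings,
which depend only on closures. If A ~ B, `exists_countable_subset_closure` gives C between A ∩ B and
A ∪ B that thickens like A ∪ B while Cᶜ thickens like (A ∩ B)ᶜ. Thus C is worst in both terms of the
risk, yet it is still a minimizer, so both thickenings have constant mass between A ∩ B and A ∪ B.
This turns A ~ B into a.e. equality of thickenings (`equivUpToDegeneracy_iff`), which is visibly
transitive. If ε = 0 or E is trivial, any two minimizers are equivalent. For the point masses, the
point 0 is within ε of both atoms, so every set has risk at least 1/2. -/

namespace AdvBayes

open Filter Topology Metric Measure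

section Topological

/-- If complements of countable sets are dense, then a set `A` can be enlarged by countably many
points of `B` so as to become dense in `B`, without changing the closure of the complement. -/
theorem exists_countable_subset_closure {X : Type*} [TopologicalSpace X]
    [SecondCountableTopology X] (hX : ∀ Q : Set X, Q.Countable → Dense Qᶜ) (A B : Set X) :
    ∃ Q : Set X, Q.Countable ∧ Q ⊆ B ∧ B ⊆ closure (A ∪ Q) ∧ Aᶜ ⊆ closure (A ∪ Q)ᶜ := by
  obtain ⟨T, hTc, hTd⟩ := TopologicalSpace.exists_countable_dense (B \ A : Set X)
  set R : Set X := Subtype.val '' T with hR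
  have hRc : R.Countable := hTc.image _
  have hRD : R ⊆ B \ A := by rintro _ ⟨x, -, rfl⟩; exact x.2
  have hDR : B \ A ⊆ closure R := by
    intro x hx
    have := image_closure_subset_closure_image continuous_subtype_val
      (mem_image_of_mem Subtype.val (hTd ⟨x, hx⟩))
    exact this
  have hsub : A ∪ R ∩ closure (A ∪ R)ᶜ ⊆ A ∪ R := union_subset_union_right _ inter_subset_left
  -- Points of R interior to A ∪ R are discarded: Rᶜ is dense, so A already accumulates at them.
  refine ⟨R ∩ closure (A ∪ R)ᶜ, hRc.mono inter_subset_left, fun x hx => (hRD hx.1).1, ?_, ?_⟩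
  · have hRcl : R ⊆ closure (A ∪ R ∩ closure (A ∪ R)ᶜ) := by
      intro q hq
      by_cases hqc : q ∈ closure (A ∪ R)ᶜ
      · exact subset_closure (Or.inr ⟨hq, hqc⟩)
      · have hqi : q ∈ interior (A ∪ R) := by
          rwa [closure_compl, mem_compl_iff, not_not] at hqc
        have h := (hX R hRc).open_subset_closure_inter isOpen_interior hqi
        refine closure_mono ?_ h
        rintro x ⟨hx, hxR⟩
        exact Or.inl ((interior_subset hx).resolve_right hxR)
    intro x hx
    by_cases hxA : x ∈ A
    · exact subset_closure (Or.inl hxA)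
    · exact closure_minimal hRcl isClosed_closure (hDR ⟨hx, hxA⟩)
  · intro x hx
    by_cases hxQ : x ∈ R ∩ closure (A ∪ R)ᶜ
    · exact closure_mono (compl_subset_compl.2 hsub) hxQ.2
    · exact subset_closure fun h => h.elim hx hxQ

end Topological

/-! ### Boundaries of thickenings are null, by Lebesgue density -/

section HaarThickening

variable {E : Type*} [NormedAddCommGroup E] [NormedSpace ℝ E] [FiniteDimensional ℝ E]
  [MeasurableSpace E] [BorelSpace E] (μ : Measure E) [μ.IsAddHaarMeasure]

/-- A set which near each of its points omits half-radius balls at all small scales is null. -/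
theorem measure_eq_zero_of_forall_ball_subset {S : Set E} {ε : ℝ} (hε : 0 < ε)
    (hS : ∀ x ∈ S, ∀ r, 0 < r → r ≤ ε → ∃ y, ball y (r / 2) ⊆ closedBall x r ∧
      Disjoint (ball y (r / 2)) S) (hSm : MeasurableSet S) : μ S = 0 := by
  by_contra hne
  have hae := Besicovitch.ae_tendsto_measure_inter_div μ S
  have : NeBot (ae (μ.restrict S)) := by
    rw [ae_neBot]; simpa [Measure.restrict_eq_zero] using hne
  obtain ⟨x, hx, hxS⟩ := (hae.and (ae_restrict_mem hSm)).exists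
  set c : ℝ≥0∞ := ENNReal.ofReal ((1 / 2 : ℝ) ^ Module.finrank ℝ E) with hc
  have hc0 : 0 < c := by rw [hc]; positivity
  -- The omitted ball takes a fraction 2^(-d) of the volume, so the density of S at x cannot be 1.
  have hle : ∀ᶠ r in 𝓝[>] (0 : ℝ), μ (S ∩ closedBall x r) / μ (closedBall x r) ≤ 1 - c := by
    filter_upwards [Ioc_mem_nhdsGT hε] with r hr
    obtain ⟨y, hy, hyS⟩ := hS x hxS r hr.1 hr.2
    have hball : μ (ball y (r / 2)) = c * μ (closedBall x r) := by
      rw [addHaar_closedBall μ x hr.1.le, ← addHaar_ball_of_pos μ 0 hr.1,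
        ← addHaar_ball_mul_of_pos μ y (by norm_num : (0 : ℝ) < 1 / 2)]
      congr 2; ring
    have hfin : μ (closedBall x r) ≠ ⊤ := measure_closedBall_lt_top.ne
    have hpos : μ (closedBall x r) ≠ 0 := (measure_closedBall_pos μ x hr.1).ne'
    have hsum : μ (S ∩ closedBall x r) + c * μ (closedBall x r) ≤ μ (closedBall x r) := by
      rw [← hball, ← measure_union (hyS.symm.mono_left inter_subset_left) measurableSet_ball]
      exact measure_mono (union_subset inter_subset_right hy)
    have hcfin : c ≠ ⊤ := ENNReal.ofReal_ne_top
    rw [ENNReal.div_le_iff hpos hfin, ENNReal.sub_mul (fun _ _ => hfin), one_mul]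
    exact ENNReal.le_sub_of_add_le_right (ENNReal.mul_ne_top hcfin hfin) hsum
  have h1 : (1 : ℝ≥0∞) ≤ 1 - c := le_of_tendsto hx hle
  exact absurd h1 (not_le.2 (ENNReal.sub_lt_self ENNReal.one_ne_top one_ne_zero hc0.ne'))

/-- The closed and the open `ε`-thickening of a set differ by a null set. -/
theorem cthickening_ae_eq_thickening {ε : ℝ} (hε : 0 < ε) (A : Set E) :
    cthickening ε A =ᵐ[μ] thickening ε A := by
  refine (ae_eq_set.2 ⟨?_, by
    rw [sdiff_eq_empty.2 (thickening_subset_cthickening ε A), measure_empty]⟩)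
  refine measure_eq_zero_of_forall_ball_subset μ hε ?_
    (isClosed_cthickening.measurableSet.diff isOpen_thickening.measurableSet)
  rintro x ⟨hxc, hxt⟩ r hr hrε
  have hne : A.Nonempty := by
    rw [nonempty_iff_ne_empty]; rintro rfl; simp at hxc
  obtain ⟨a, ha, had⟩ := exists_mem_closure_infDist_eq_dist hne x
  have hdist : dist x a = ε := by
    rw [mem_thickening_iff_infDist_lt hne, not_lt] at hxt
    have : infDist x A ≤ ε := ENNReal.toReal_le_of_le_ofReal hε.le (mem_cthickening_iff.1 hxc)
    linarith
  have hnorm : ‖a - x‖ = ε := by rw [← hdist, dist_comm, dist_eq_norm]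
  -- y lies on the segment from x to a nearest point a of the closure, at distance r/2 from x.
  set y : E := x + (r / (2 * ε)) • (a - x) with hy
  have hyx : dist y x = r / 2 := by
    rw [hy, dist_eq_norm, add_sub_cancel_left, norm_smul, hnorm, Real.norm_eq_abs,
      abs_of_pos (by positivity)]
    field_simp
  have hya : dist y a = ε - r / 2 := by
    have : y - a = -((1 - r / (2 * ε)) • (a - x)) := by rw [hy]; module
    have h1 : 0 ≤ 1 - r / (2 * ε) := by
      rw [sub_nonneg, div_le_one (by positivity)]; linarith
    rw [dist_eq_norm, this, norm_neg, norm_smul, hnorm, Real.norm_eq_abs, abs_of_nonneg h1]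
    field_simp
  refine ⟨y, fun z hz => ?_, ?_⟩
  · rw [mem_ball] at hz
    rw [mem_closedBall]
    linarith [dist_triangle z y x]
  · refine Set.disjoint_left.2 fun z hz hzS => hzS.2 ?_
    rw [mem_ball] at hz
    rw [← thickening_closure, mem_thickening_iff]
    exact ⟨a, ha, by linarith [dist_triangle z y a]⟩

end HaarThickening

/-! ### Risk in terms of dilations -/

section Risk

variable {E : Type*} [NormedAddCommGroup E]

/-- The closed-ball dilation `{x | ∃ h, ‖h‖ ≤ ε ∧ x + h ∈ A}` of a set. -/
def dilation (ε : ℝ) (A : Set E) : Set E := {x | ∃ h : E, ‖h‖ ≤ ε ∧ x + h ∈ A}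

theorem mem_dilation {ε : ℝ} {A : Set E} {x : E} :
    x ∈ dilation ε A ↔ ∃ h : E, ‖h‖ ≤ ε ∧ x + h ∈ A := Iff.rfl

theorem supBall_indicator (ε : ℝ) (A : Set E) :
    supBall ε (A.indicator fun _ => 1) =
      (dilation ε A).indicator fun _ => (1 : ℝ≥0∞) := by
  classical
  funext x
  by_cases hx : x ∈ dilation ε A
  · rw [indicator_of_mem hx]
    obtain ⟨h, hh, hA⟩ := hx
    refine le_antisymm (iSup₂_le fun k _ => indicator_le_self' (by simp) _) ?_
    refine le_iSup₂_of_le h hh ?_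
    rw [indicator_of_mem hA]
  · rw [indicator_of_notMem hx]
    refine le_antisymm (iSup₂_le fun k hk => ?_) zero_le
    rw [indicator_of_notMem fun hA => hx ⟨k, hk, hA⟩]

theorem thickening_subset_dilation (ε : ℝ) (A : Set E) :
    thickening ε A ⊆ dilation ε A := by
  intro x hx
  obtain ⟨a, ha, hxa⟩ := mem_thickening_iff.1 hx
  exact ⟨a - x, by rw [← dist_eq_norm, dist_comm]; exact hxa.le, by simpa using ha⟩

theorem dilation_subset_cthickening (ε : ℝ) (A : Set E) :
    dilation ε A ⊆ cthickening ε A := by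
  rintro x ⟨h, hh, hA⟩
  exact mem_cthickening_of_dist_le x (x + h) ε A hA (by simpa [dist_eq_norm] using hh)

variable [MeasurableSpace E]

theorem lintegral_completion_supBall_indicator {P : Measure E} {ε : ℝ} {A T : Set E}
    (hT : MeasurableSet T) (hAT : dilation ε A =ᵐ[P] T) :
    ∫⁻ x, supBall ε (A.indicator fun _ => 1) x ∂P.completion = P T := by
  rw [supBall_indicator, lintegral_congr_ae (μ := P.completion)
    (show (dilation ε A).indicator _ =ᵐ[P] T.indicator _ from indicator_ae_eq_of_ae_eq_set hAT)]
  have hT' : MeasurableSet (α := NullMeasurableSpace E P) T := hT.nullMeasurableSet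
  exact (lintegral_indicator_const hT' 1).trans
    ((one_mul _).trans (Measure.completion_apply P T))

variable {P₀ P₁ : Measure E} {ε : ℝ}

theorem IsAdvBayesClassifier.of_advRisk_le {A B : Set E} (hA : IsAdvBayesClassifier ε P₀ P₁ A)
    (hB : MeasurableSet B) (h : advRisk ε P₀ P₁ B ≤ advRisk ε P₀ P₁ A) :
    IsAdvBayesClassifier ε P₀ P₁ B :=
  ⟨hB, fun C hC => h.trans (hA.2 C hC)⟩

theorem IsAdvBayesClassifier.advRisk_eq {A B : Set E} (hA : IsAdvBayesClassifier ε P₀ P₁ A)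
    (hB : IsAdvBayesClassifier ε P₀ P₁ B) : advRisk ε P₀ P₁ A = advRisk ε P₀ P₁ B :=
  le_antisymm (hA.2 B hB.1) (hB.2 A hA.1)

theorem equivUpToDegeneracy_refl (A : AdvBayesClassifier ε P₀ P₁) : EquivUpToDegeneracy A A := by
  intro B _ h1 h2
  rw [inter_self] at h1
  rw [union_self] at h2
  rw [← subset_antisymm h1 h2]
  exact A.2

theorem EquivUpToDegeneracy.symm {A B : AdvBayesClassifier ε P₀ P₁}
    (h : EquivUpToDegeneracy A B) : EquivUpToDegeneracy B A := by
  intro C hC h1 h2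
  exact h C hC (by rwa [inter_comm]) (by rwa [union_comm])

end Risk

/-! ### The case without perturbation -/

section NoPerturbation

variable {E : Type*} [NormedAddCommGroup E] [MeasurableSpace E] {P₀ P₁ : Measure E} {ε : ℝ}

theorem advRisk_of_norm_le_iff (hε : ∀ h : E, ‖h‖ ≤ ε ↔ h = 0) {A : Set E}
    (hA : MeasurableSet A) : advRisk ε P₀ P₁ A = P₁ Aᶜ + P₀ A := by
  have hset : ∀ B : Set E, dilation ε B = B := by
    intro B; ext x; simp [mem_dilation, hε]
  rw [advRisk, lintegral_completion_supBall_indicator hA.compl (hset _).eventuallyEq,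
    lintegral_completion_supBall_indicator hA (hset _).eventuallyEq]

/-- Without perturbations, any two adversarial Bayes classifiers are equivalent. -/
theorem equivUpToDegeneracy_of_norm_le_iff [IsFiniteMeasure P₀] [IsFiniteMeasure P₁]
    (hε : ∀ h : E, ‖h‖ ≤ ε ↔ h = 0) (A₁ A₂ : AdvBayesClassifier ε P₀ P₁) :
    EquivUpToDegeneracy A₁ A₂ := by
  obtain ⟨A, hA⟩ := A₁
  obtain ⟨B, hB⟩ := A₂
  -- Removing part of a minimizer, or (below) adding to it, cannot lower the risk.
  have key : ∀ {A : Set E}, IsAdvBayesClassifier ε P₀ P₁ A → ∀ D, MeasurableSet D → D ⊆ A →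
      P₀ D ≤ P₁ D := by
    intro A hA D hD hDA
    have h := hA.2 (A \ D) (hA.1.diff hD)
    rw [advRisk_of_norm_le_iff hε hA.1, advRisk_of_norm_le_iff hε (hA.1.diff hD), sdiff_eq,
      compl_inter, compl_compl, measure_union (disjoint_compl_left_iff_subset.2 hDA) hD,
      ← sdiff_eq, ← measure_inter_add_sdiff A hD, inter_eq_self_of_subset_right hDA,
      add_assoc] at h
    have h' := (ENNReal.add_le_add_iff_left (measure_ne_top P₁ _)).1 h
    exact (ENNReal.add_le_add_iff_right (measure_ne_top P₀ _)).1 h'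
  have key' : ∀ {A : Set E}, IsAdvBayesClassifier ε P₀ P₁ A → ∀ D, MeasurableSet D → D ⊆ Aᶜ →
      P₁ D ≤ P₀ D := by
    intro A hA D hD hDA
    have h := hA.2 (A ∪ D) (hA.1.union hD)
    rw [advRisk_of_norm_le_iff hε hA.1, advRisk_of_norm_le_iff hε (hA.1.union hD),
      compl_union, ← sdiff_eq, measure_union (subset_compl_iff_disjoint_left.1 hDA) hD, ← measure_inter_add_sdiff Aᶜ hD,
      inter_eq_self_of_subset_right hDA] at h
    rw [add_comm (P₁ D), add_assoc] at h
    have h' := (ENNReal.add_le_add_iff_left (measure_ne_top P₁ _)).1 h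
    rw [add_comm (P₁ D)] at h'
    exact (ENNReal.add_le_add_iff_left (measure_ne_top P₀ _)).1 h'
  intro C hC h1 h2
  have hAC : MeasurableSet (A \ C) := hA.1.diff hC
  have hCA : MeasurableSet (C \ A) := hC.diff hA.1
  refine hA.of_advRisk_le hC ?_
  -- A \ C avoids B and C \ A lies in B, so minimality of B controls both changes from A to C.
  have e1 : P₁ (A \ C) ≤ P₀ (A \ C) :=
    key' hB _ hAC fun x hx hxB => hx.2 (h1 ⟨hx.1, hxB⟩)
  have e2 : P₀ (C \ A) ≤ P₁ (C \ A) :=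
    key hB _ hCA fun x hx => (h2 hx.1).resolve_left hx.2
  rw [advRisk_of_norm_le_iff hε hA.1, advRisk_of_norm_le_iff hε hC,
    ← measure_inter_add_sdiff A hC, ← measure_inter_add_sdiff C hA.1,
    ← measure_inter_add_sdiff Aᶜ hC, ← measure_inter_add_sdiff Cᶜ hA.1,
    inter_comm C A, show Cᶜ ∩ A = A \ C by rw [inter_comm]; rfl,
    show Aᶜ ∩ C = C \ A by rw [inter_comm]; rfl,
    show Cᶜ \ A = Aᶜ \ C by rw [sdiff_eq, sdiff_eq, inter_comm]]
  calc P₁ (A \ C) + P₁ (Aᶜ \ C) + (P₀ (A ∩ C) + P₀ (C \ A))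
      ≤ P₀ (A \ C) + P₁ (Aᶜ \ C) + (P₀ (A ∩ C) + P₁ (C \ A)) := by gcongr
    _ = P₁ (C \ A) + P₁ (Aᶜ \ C) + (P₀ (A ∩ C) + P₀ (A \ C)) := by ring

end NoPerturbation

/-! ### Characterization by thickenings -/

section AbsolutelyContinuous

variable {E : Type*} [NormedAddCommGroup E] [NormedSpace ℝ E] [FiniteDimensional ℝ E]
  [MeasurableSpace E] [BorelSpace E] {μ : Measure E} [μ.IsAddHaarMeasure] {P₀ P₁ : Measure E}
  {ε : ℝ}

/-- For absolutely continuous measures the risk can be computed with open thickenings. -/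
theorem advRisk_eq_measure_thickening (hε : 0 < ε) (h₀ : P₀ ≪ μ) (h₁ : P₁ ≪ μ) (A : Set E) :
    advRisk ε P₀ P₁ A = P₁ (thickening ε Aᶜ) + P₀ (thickening ε A) := by
  have hae : ∀ {P : Measure E}, P ≪ μ → ∀ B : Set E,
      dilation ε B =ᵐ[P] thickening ε B := fun hP B =>
    (((dilation_subset_cthickening ε B).eventuallyLE).trans
      (hP.ae_eq (cthickening_ae_eq_thickening μ hε B)).le).antisymm
      (thickening_subset_dilation ε B).eventuallyLE
  rw [advRisk,
    lintegral_completion_supBall_indicator isOpen_thickening.measurableSet (hae h₁ Aᶜ),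
    lintegral_completion_supBall_indicator isOpen_thickening.measurableSet (hae h₀ A)]

variable [IsFiniteMeasure P₀] [IsFiniteMeasure P₁]

/-- If all measurable sets between nested `A ⊆ B` are adversarial Bayes classifiers, then the
thickenings of `A` and `B`, and of their complements, have the same mass. -/
theorem measure_thickening_eq_of_forall_between [Nontrivial E] (hε : 0 < ε) (h₀ : P₀ ≪ μ)
    (h₁ : P₁ ≪ μ) {A B : Set E} (hAB : A ⊆ B) (hA : MeasurableSet A) (hB : MeasurableSet B)
    (h : ∀ C, MeasurableSet C → A ⊆ C → C ⊆ B → IsAdvBayesClassifier ε P₀ P₁ C) :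
    P₀ (thickening ε A) = P₀ (thickening ε B) ∧ P₁ (thickening ε Aᶜ) = P₁ (thickening ε Bᶜ) := by
  obtain ⟨Q, hQc, hQB, hBQ, hAQ⟩ := exists_countable_subset_closure
    (fun Q hQ => hQ.dense_compl ℝ) A B
  have hACB : A ∪ Q ⊆ B := union_subset hAB hQB
  have hC := h (A ∪ Q) (hA.union hQc.measurableSet) subset_union_left hACB
  have thick : ∀ {S T : Set E}, S ⊆ T → T ⊆ closure S → thickening ε S = thickening ε T := by
    intro S T h1 h2
    refine subset_antisymm (thickening_subset_of_subset _ h1) ?_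
    rw [← thickening_closure (s := S)]
    exact thickening_subset_of_subset _ h2
  have t0 := thick hACB hBQ
  have t1 := thick (compl_subset_compl.2 (subset_union_left (s := A) (t := Q))) hAQ
  have hAm := h A hA subset_rfl hAB
  have hBm := h B hB hAB subset_rfl
  have r1 := hC.advRisk_eq hAm
  have r2 := hC.advRisk_eq hBm
  rw [advRisk_eq_measure_thickening hε h₀ h₁, advRisk_eq_measure_thickening hε h₀ h₁] at r1 r2
  rw [t1] at r1
  rw [t0] at r2
  have e0 := (ENNReal.add_right_inj (measure_ne_top P₁ _)).1 r1
  have e1 := (ENNReal.add_left_inj (measure_ne_top P₀ _)).1 r2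
  exact ⟨by rw [← e0, t0], by rw [← e1, t1]⟩

/-- For absolutely continuous measures, two adversarial Bayes classifiers are equivalent up to
degeneracy iff their thickenings agree `P₀`-a.e. and those of their complements agree
`P₁`-a.e. -/
theorem equivUpToDegeneracy_iff [Nontrivial E] (hε : 0 < ε) (h₀ : P₀ ≪ μ) (h₁ : P₁ ≪ μ)
    (A₁ A₂ : AdvBayesClassifier ε P₀ P₁) :
    EquivUpToDegeneracy A₁ A₂ ↔
      thickening ε A₁.1 =ᵐ[P₀] thickening ε A₂.1 ∧
        thickening ε A₁.1ᶜ =ᵐ[P₁] thickening ε A₂.1ᶜ := by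
  obtain ⟨A, hA⟩ := A₁
  obtain ⟨B, hB⟩ := A₂
  constructor
  · intro h
    obtain ⟨e0, e1⟩ := measure_thickening_eq_of_forall_between hε h₀ h₁
      (inter_subset_left.trans (subset_union_left (s := A) (t := B)))
      (hA.1.inter hB.1) (hA.1.union hB.1) h
    have ae_of : ∀ (P : Measure E) [IsFiniteMeasure P] {S T U : Set E}, S ⊆ T → T ⊆ U →
        P (thickening ε S) = P (thickening ε U) → thickening ε T =ᵐ[P] thickening ε U := by
      intro P _ S T U hST hTU hSU
      refine ae_eq_of_subset_of_measure_ge (thickening_subset_of_subset _ hTU) ?_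
        isOpen_thickening.measurableSet.nullMeasurableSet (measure_ne_top P _)
      rw [← hSU]
      exact measure_mono (thickening_subset_of_subset _ hST)
    exact ⟨(ae_of P₀ inter_subset_left subset_union_left e0).trans
        (ae_of P₀ inter_subset_right subset_union_right e0).symm,
      (ae_of P₁ (compl_subset_compl.2 subset_union_left)
          (compl_subset_compl.2 inter_subset_left) e1.symm).trans
        (ae_of P₁ (compl_subset_compl.2 subset_union_right)
          (compl_subset_compl.2 inter_subset_right) e1.symm).symm⟩
  · rintro ⟨e0, e1⟩ C hC hC1 hC2
    refine hA.of_advRisk_le hC ?_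
    rw [advRisk_eq_measure_thickening hε h₀ h₁, advRisk_eq_measure_thickening hε h₀ h₁]
    -- Thickening commutes with unions, so each term for C is at most that for A.
    have le_of : ∀ (P : Measure E) {S T U : Set E}, U ⊆ S ∪ T →
        thickening ε S =ᵐ[P] thickening ε T → P (thickening ε U) ≤ P (thickening ε S) := by
      intro P S T U hU hST
      calc P (thickening ε U) ≤ P (thickening ε S ∪ thickening ε T) := by
            rw [← thickening_union]
            exact measure_mono (thickening_subset_of_subset _ hU)
        _ = P (thickening ε S ∪ thickening ε S) := measure_congr ((ae_eq_refl _).union hST.symm)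
        _ = P (thickening ε S) := by rw [union_self]
    refine add_le_add (le_of P₁ ?_ e1) (le_of P₀ hC2 e0)
    rw [← compl_inter]
    exact compl_subset_compl.2 hC1

theorem equivalence_equivUpToDegeneracy (hε : 0 ≤ ε) (h₀ : P₀ ≪ μ) (h₁ : P₁ ≪ μ) :
    Equivalence
      (EquivUpToDegeneracy : AdvBayesClassifier ε P₀ P₁ → AdvBayesClassifier ε P₀ P₁ → Prop) := by
  refine ⟨equivUpToDegeneracy_refl, EquivUpToDegeneracy.symm, fun {A B C} hAB hBC => ?_⟩
  rcases hε.eq_or_lt with rfl | hε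
  · exact equivUpToDegeneracy_of_norm_le_iff (fun _ => norm_le_zero_iff) A C
  -- In a trivial space countable sets need not have dense complement.
  cases subsingleton_or_nontrivial E
  · refine equivUpToDegeneracy_of_norm_le_iff (fun h => ?_) A C
    simp [Subsingleton.elim h 0, hε.le]
  · rw [equivUpToDegeneracy_iff hε h₀ h₁] at hAB hBC ⊢
    exact ⟨hAB.1.trans hBC.1, hAB.2.trans hBC.2⟩

end AbsolutelyContinuous

/-! ### Two atoms: failure of transitivity -/

section PointMasses

variable {ε : ℝ}

theorem lintegral_completion_dirac {X : Type*} [MeasurableSpace X] [MeasurableSingletonClass X]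
    (c : ℝ≥0∞) (a : X) (f : X → ℝ≥0∞) :
    ∫⁻ x, f x ∂(c • dirac a).completion = c * f a := by
  have hf : f =ᵐ[(c • dirac a).completion] fun _ => f a := by
    exact Measure.ae_smul_measure (ae_eq_dirac f) c
  have huniv : (c • dirac a).completion univ = c :=
    (Measure.completion_apply (c • dirac a) univ).trans (by simp)
  rw [lintegral_congr_ae hf, lintegral_const, huniv, mul_comm]

open Classical in
theorem advRisk_dirac (A : Set ℝ) :
    advRisk ε ((2⁻¹ : ℝ≥0∞) • dirac (-ε)) ((2⁻¹ : ℝ≥0∞) • dirac ε) A =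
      (if ∃ y ∉ A, 0 ≤ y ∧ y ≤ 2 * ε then 2⁻¹ else 0) +
        if ∃ y ∈ A, -(2 * ε) ≤ y ∧ y ≤ 0 then 2⁻¹ else 0 := by
  have key : ∀ (a : ℝ) (B : Set ℝ), a ∈ dilation ε B ↔
      ∃ y ∈ B, a - ε ≤ y ∧ y ≤ a + ε := by
    intro a B
    constructor
    · rintro ⟨h, hh, hB⟩
      rw [Real.norm_eq_abs, abs_le] at hh
      exact ⟨_, hB, by linarith, by linarith⟩
    · rintro ⟨y, hy, h1, h2⟩
      refine ⟨y - a, ?_, by simpa using hy⟩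
      rw [Real.norm_eq_abs, abs_le]
      constructor <;> linarith
  rw [advRisk, lintegral_completion_dirac, lintegral_completion_dirac, supBall_indicator,
    supBall_indicator, indicator_apply, indicator_apply]
  simp only [key, sub_self, show ε + ε = 2 * ε by ring, show -ε - ε = -(2 * ε) by ring,
    neg_add_cancel, mul_ite, mul_one, mul_zero, mem_compl_iff]

theorem inv_two_le_advRisk_dirac (hε : 0 < ε) (A : Set ℝ) :
    2⁻¹ ≤ advRisk ε ((2⁻¹ : ℝ≥0∞) • dirac (-ε)) ((2⁻¹ : ℝ≥0∞) • dirac ε) A := by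
  classical
  rw [advRisk_dirac]
  by_cases h : (0 : ℝ) ∈ A
  · rw [if_pos (⟨0, h, by linarith, le_rfl⟩ : ∃ y ∈ A, -(2 * ε) ≤ y ∧ y ≤ 0)]
    exact le_add_self
  · rw [if_pos (⟨0, h, le_rfl, by linarith⟩ : ∃ y ∉ A, 0 ≤ y ∧ y ≤ 2 * ε)]
    exact le_self_add

theorem isAdvBayesClassifier_dirac_of_Ici_subset (hε : 0 < ε) {A : Set ℝ} (hA : MeasurableSet A)
    (h : Ici 0 ⊆ A) :
    IsAdvBayesClassifier ε ((2⁻¹ : ℝ≥0∞) • dirac (-ε)) ((2⁻¹ : ℝ≥0∞) • dirac ε) A := by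
  classical
  refine ⟨hA, fun B _ => le_trans ?_ (inv_two_le_advRisk_dirac hε B)⟩
  rw [advRisk_dirac, if_neg, zero_add]
  · split_ifs <;> simp
  · rintro ⟨y, hy, h0, -⟩
    exact hy (h h0)

theorem isAdvBayesClassifier_dirac_Ioi (hε : 0 < ε) :
    IsAdvBayesClassifier ε ((2⁻¹ : ℝ≥0∞) • dirac (-ε)) ((2⁻¹ : ℝ≥0∞) • dirac ε) (Ioi 0) := by
  classical
  refine ⟨measurableSet_Ioi, fun B _ => le_trans ?_ (inv_two_le_advRisk_dirac hε B)⟩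
  rw [advRisk_dirac, if_neg (c := ∃ y ∈ Ioi (0 : ℝ), -(2 * ε) ≤ y ∧ y ≤ 0), add_zero]
  · split_ifs <;> simp
  · rintro ⟨y, hy, -, h0⟩
    exact absurd hy (not_lt.2 h0)

/-- The missing point 0 costs 1/2 at the atom ε and the extra point -ε costs 1/2 at the atom -ε, so
the risk is 1. -/
theorem not_isAdvBayesClassifier_dirac (hε : 0 < ε) :
    ¬ IsAdvBayesClassifier ε ((2⁻¹ : ℝ≥0∞) • dirac (-ε)) ((2⁻¹ : ℝ≥0∞) • dirac ε)
      (Ioi 0 ∪ {-ε}) := by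
  classical
  intro h
  have hle := (h.2 _ (isAdvBayesClassifier_dirac_Ioi hε).1)
  rw [advRisk_dirac, advRisk_dirac, if_pos, if_pos, if_pos, if_neg, add_zero,
    ENNReal.inv_two_add_inv_two] at hle
  · exact absurd hle (not_le.2 (by simp))
  · rintro ⟨y, hy, -, h0⟩
    exact absurd hy (not_lt.2 h0)
  · exact ⟨0, by simp, le_rfl, by linarith⟩
  · exact ⟨-ε, by simp, by linarith, by linarith⟩
  · exact ⟨0, by simp [hε.ne'], le_rfl, by linarith⟩

end PointMasses

end AdvBayes

theorem mainTheorem2 :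
    -- The main claim, on a finite-dimensional real normed space (`ℝ^d` with an arbitrary norm).
    (∀ (E : Type*) [NormedAddCommGroup E] [NormedSpace ℝ E] [FiniteDimensional ℝ E]
        [MeasurableSpace E] [BorelSpace E] (μ : Measure E) [μ.IsAddHaarMeasure]
        (P₀ P₁ : Measure E) [IsFiniteMeasure P₀] [IsFiniteMeasure P₁] (ε : ℝ),
        0 ≤ ε → P₀ + P₁ ≪ μ →
        Equivalence
          (AdvBayes.EquivUpToDegeneracy :
            AdvBayes.AdvBayesClassifier ε P₀ P₁ → AdvBayes.AdvBayesClassifier ε P₀ P₁ → Prop)) ∧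
    -- The example on `ℝ` with two point masses, where transitivity fails.
    (∀ ε : ℝ, 0 < ε → ∀ P₀ P₁ : Measure ℝ,
        P₀ = (2⁻¹ : ℝ≥0∞) • Measure.dirac (-ε) → P₁ = (2⁻¹ : ℝ≥0∞) • Measure.dirac ε →
        ∃ A₁ A₂ A₃ : AdvBayes.AdvBayesClassifier ε P₀ P₁,
          A₁.1 = Ioi 0 ∧ A₂.1 = Ici 0 ∧ A₃.1 = univ ∧
          AdvBayes.EquivUpToDegeneracy A₁ A₂ ∧ AdvBayes.EquivUpToDegeneracy A₂ A₃ ∧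
          ¬ AdvBayes.EquivUpToDegeneracy A₁ A₃ ∧
          ¬ Equivalence
            (AdvBayes.EquivUpToDegeneracy :
              AdvBayes.AdvBayesClassifier ε P₀ P₁ → AdvBayes.AdvBayesClassifier ε P₀ P₁ →
                Prop)) := by
  refine ⟨?_, ?_⟩
  · intro E _ _ _ _ _ μ _ P₀ P₁ _ _ ε hε hP
    exact AdvBayes.equivalence_equivUpToDegeneracy (μ := μ) hε
      ((Measure.le_add_right le_rfl).absolutelyContinuous.trans hP)
      ((Measure.le_add_left le_rfl).absolutelyContinuous.trans hP)
  · rintro ε hε _ _ rfl rfl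
    refine ⟨⟨Ioi 0, AdvBayes.isAdvBayesClassifier_dirac_Ioi hε⟩,
      ⟨Ici 0, AdvBayes.isAdvBayesClassifier_dirac_of_Ici_subset hε measurableSet_Ici subset_rfl⟩,
      ⟨univ, AdvBayes.isAdvBayesClassifier_dirac_of_Ici_subset hε .univ (subset_univ _)⟩,
      rfl, rfl, rfl, ?_⟩
    rw [← and_assoc, ← and_assoc]
    -- The last conjunct follows from the others by transitivity.
    refine (and_iff_left_of_imp fun h hE => h.2 (hE.trans h.1.1 h.1.2)).2 ⟨⟨?_, ?_⟩, ?_⟩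
    · intro B hB h1 h2
      have h1' : Ioi (0 : ℝ) ⊆ B := fun x hx => h1 ⟨hx, Ioi_subset_Ici_self hx⟩
      have h2' : B ⊆ Ici (0 : ℝ) := h2.trans (union_subset Ioi_subset_Ici_self subset_rfl)
      by_cases h0 : (0 : ℝ) ∈ B
      · refine AdvBayes.isAdvBayesClassifier_dirac_of_Ici_subset hε hB fun x hx => ?_
        rcases (mem_Ici.1 hx).eq_or_lt with rfl | hx
        exacts [h0, h1' hx]
      · have : B = Ioi 0 := subset_antisymm
          (fun x hx => lt_of_le_of_ne (mem_Ici.1 (h2' hx)) fun h => h0 (h.symm ▸ hx)) h1'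
        rw [this]
        exact AdvBayes.isAdvBayesClassifier_dirac_Ioi hε
    · intro B hB h1 _
      exact AdvBayes.isAdvBayesClassifier_dirac_of_Ici_subset hε hB
        fun x hx => h1 ⟨hx, mem_univ x⟩
    · intro h
      exact AdvBayes.not_isAdvBayesClassifier_dirac hε
        (h _ (measurableSet_Ioi.union (measurableSet_singleton _))
          (fun x hx => Or.inl hx.1) fun x _ => Or.inr (mem_univ x))
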